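/- Let $m, d, n$ be natural numbers with $n \ge d \ge 2m$. There exists a non-empty set of actions $\mathcal{A} \subset \{0,1\}^d$ with $\|a\|_1 = m$ for all $a \in \mathcal{A}$ such that $$\inf_{\text{strategies}}\ \sup_{\text{adversaries}}\ R_n \;\ge\; 0.02\, m \sqrt{d n},$$ where the infimum is over all player strategies under bandit feedback, the supremum is over all adversaries, and the game and the regret $R_n$ are as follows. In each round $t = 1, \dots, n$ the player chooses a probability distribution $p_t$ on $\mathcal{A}$ and draws $a_t \in \mathcal{A}$ from $p_t$, while the adversary simultaneously chooses a loss vector $z_t \in [0,1]^d$. A strategy of the player under bandit feedback specifies, for each $t$, the distribution $p_t$ as a measurable function of $(p_s, a_s, a_s^T z_s)_{s<t}$. An adversary specifies, for each $t$, the vector $z_t$ as a measurable function of $(p_s, a_s, z_s)_{s<t}$. The regret is $$R_n = \mathbb{E} \sum_{t=1}^n a_t^T z_t - \min_{a \in \mathcal{A}} \mathbb{E} \sum_{t=1}^n a^T z_t,$$ the expectation being over the random draws of the actions $a_1, \dots, a_n$. -/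

import Mathlib

noncomputable section

namespace OnlineCombinatorial

variable {d : ℕ}

/-- A loss vector `z ∈ [0,1]^d`. -/
abbrev LossVector (d : ℕ) : Type := Fin d → Set.Icc (0 : ℝ) 1

/-- The loss `aᵀ z` incurred by the action `a` against the loss vector `z`. -/
def loss (a : Fin d → ℝ) (z : LossVector d) : ℝ := ∑ i, a i * (z i : ℝ)

/-- Probability distributions on the finite action set `A`. -/
abbrev Distribution (A : Finset (Fin d → ℝ)) : Type := stdSimplex ℝ A

/-- Everything that happens in one round: the player's distribution `p`, the action `a` drawn
from it, and the adversary's loss vector `z`. -/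
abbrev Round (A : Finset (Fin d → ℝ)) : Type := Distribution A × A × LossVector d

/-- What the player knows about one round under bandit feedback: her distribution `p`, her
action `a`, and the incurred loss `aᵀ z`. -/
abbrev BanditRound (A : Finset (Fin d → ℝ)) : Type := Distribution A × A × ℝ

/-- The bandit feedback `(p, a, aᵀ z)` of a round `(p, a, z)`. -/
def banditFeedback {A : Finset (Fin d → ℝ)} (r : Round A) : BanditRound A :=
  (r.1, r.2.1, loss (r.2.1 : Fin d → ℝ) r.2.2)

/-- A strategy of the player under bandit feedback: in each round, the distribution of the next
action is a measurable function of `(p_s, a_s, a_sᵀ z_s)` for the past rounds `s`. Rounds are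
numbered `0, 1, 2, …`, so `t` rounds precede round `t`. -/
structure BanditStrategy (A : Finset (Fin d → ℝ)) where
  next : (t : ℕ) → (Fin t → BanditRound A) → Distribution A
  measurable_next : ∀ t, Measurable (next t)

/-- An adversary: in each round, the next loss vector is a measurable function of
`(p_s, a_s, z_s)` for the past rounds `s`. -/
structure Adversary (A : Finset (Fin d → ℝ)) where
  next : (t : ℕ) → (Fin t → Round A) → LossVector d
  measurable_next : ∀ t, Measurable (next t)

variable {A : Finset (Fin d → ℝ)}

/-- The full record of the first `t` rounds, given the actions `a` drawn in these rounds. -/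
def transcript (σ : BanditStrategy A) (τ : Adversary A) :
    (t : ℕ) → (Fin t → A) → (Fin t → Round A)
  | 0, _ => Fin.elim0
  | t + 1, a =>
    Fin.snoc (α := fun _ => Round A) (transcript σ τ t (Fin.init a))
      (σ.next t (fun s => banditFeedback (transcript σ τ t (Fin.init a) s)),
        a (Fin.last t),
        τ.next t (transcript σ τ t (Fin.init a)))

/-- The probability that `a` is the sequence of actions drawn in the first `n` rounds: in each
round the action is drawn from the player's current distribution, so it is the product of the
conditional probabilities `p_t(a_t)`. -/
def playProb (σ : BanditStrategy A) (τ : Adversary A) (n : ℕ) (a : Fin n → A) : ℝ :=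
  ∏ t, ((transcript σ τ n a t).1 : A → ℝ) (a t)

/-- The expectation, over the random actions, of a function of the first `n` rounds. -/
def expectation (σ : BanditStrategy A) (τ : Adversary A) (n : ℕ)
    (X : (Fin n → Round A) → ℝ) : ℝ :=
  ∑ a : Fin n → A, playProb σ τ n a * X (transcript σ τ n a)

/-- The regret `R_n = 𝔼 ∑ₜ aₜᵀ zₜ - min_{b ∈ A} 𝔼 ∑ₜ bᵀ zₜ`. -/
def regret (hA : A.Nonempty) (σ : BanditStrategy A) (τ : Adversary A) (n : ℕ) : ℝ :=
  expectation σ τ n (fun h => ∑ t, loss ((h t).2.1 : Fin d → ℝ) (h t).2.2) -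
    A.inf' hA (fun b => expectation σ τ n (fun h => ∑ t, loss b (h t).2.2))

end OnlineCombinatorial

end

/-!
The lower bound is a multi-task bandit argument. The coordinates are split into `m` blocks, the
residue classes modulo `m`, and the actions choose one coordinate from each block, so that the
player faces `m` bandit problems with about `d / m` arms each, but observes only the sum of the `m`
losses. The adversary prefers one hidden coordinate `J i` in each block `i` and is oblivious: its
loss vectors are drawn independently from a finite law, and the regret for some outcome is at
least the mean regret (`exists_le_regret`).

The point is to make the sum of the losses as uninformative as the sum of `m` fair coins. Each
coordinate of a loss vector is the mean of its own coin, fair for the preferred coordinates and of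
bias `e` for the others, and of the average of `m` fair coins shared by all coordinates
(`noisyLoss`). The incurred loss is then half the number of heads among `2 m` coins, of which at
least `m + 1` are fair when a preferred coordinate is chosen. Replacing one of these fair coins by
one of bias `e` changes the law of the number of heads by at most `4 e² / (m + 1)` in `χ²`
divergence (`sum_sq_countLaw_update_sub_div_le`): given the number of heads the fair coins are
exchangeable, so the score of the change may be replaced by the average sign of `m + 1`
independent fair coins.

By the chain rule for the relative entropy (`relEntropy_pathProb_le`) and Pinsker's inequality
(`sum_mul_le_add_sqrt_relEntropy`), making `J i` preferred raises the expected number of its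
selections from `N`, its value when block `i` has no preferred coordinate, by at most
`n √(2 e² N / (m + 1))` (`expectedCount_bias_le`). On average over the `k` coordinates of the block
`N` is `n / k`, so for some `J` the player finds the preferred coordinate in a block of size `k` in
at most a fraction `1 / k + √(2 e² n / ((m + 1) k))` of the rounds, on average over the blocks. With
`e = 0.16 √(d / n)` this average is at most `3 / 4`, and each failure costs `e / 2`. The number of
blocks need not divide `d`; what matters is that the block sizes differ by at most one
(`sum_inv_card_residueBlock_le`).
-/

namespace OnlineCombinatorial

open Finset

/-! ### Pinsker's inequality for finite distributions -/

/-- A rational lower bound of the logarithm that agrees with it to third order at `1`; it is the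
pointwise form of Pinsker's inequality. -/
lemma rational_le_log {x : ℝ} (hx : 0 < x) :
    (x - 1) * (5 * x + 1) / (2 * x * (x + 2)) ≤ Real.log x := by
  set ψ : ℝ → ℝ := fun x => Real.log x - (x - 1) * (5 * x + 1) / (2 * x * (x + 2)) with hψ
  have hd : ∀ y : ℝ, 0 < y → HasDerivAt ψ ((y - 1) ^ 3 / (y ^ 2 * (y + 2) ^ 2)) y := by
    intro y hy
    have h0 : (2 * y * (y + 2)) ≠ 0 := by positivity
    have h1 := (Real.hasDerivAt_log hy.ne').sub
      ((((hasDerivAt_id y).sub_const 1).mul (((hasDerivAt_id y).const_mul 5).add_const 1)).div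
        (((hasDerivAt_id y).const_mul 2).mul ((hasDerivAt_id y).add_const 2)) h0)
    refine h1.congr_deriv ?_
    simp only [id, Pi.mul_apply]
    field_simp
    ring
  have h1 : ψ 1 = 0 := by simp [hψ]
  suffices h : 0 ≤ ψ x by simpa [hψ] using h
  rw [← h1]
  rcases le_total 1 x with h | h
  · have hmono : MonotoneOn ψ (Set.Ici 1) := by
      refine monotoneOn_of_deriv_nonneg (convex_Ici 1)
        (fun y hy => (hd y (zero_lt_one.trans_le hy)).continuousAt.continuousWithinAt)
        (fun y hy => ?_) (fun y hy => ?_)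
      all_goals
        rw [interior_Ici] at hy
        have hy' : (1 : ℝ) < y := hy
      · exact (hd y (by linarith)).differentiableAt.differentiableWithinAt
      · rw [(hd y (by linarith)).deriv]
        have : 0 ≤ y - 1 := by linarith
        positivity
    exact hmono (Set.mem_Ici.2 le_rfl) (Set.mem_Ici.2 h) h
  · have hanti : AntitoneOn ψ (Set.Ioc 0 1) := by
      refine antitoneOn_of_deriv_nonpos (convex_Ioc 0 1)
        (fun y hy => (hd y hy.1).continuousAt.continuousWithinAt)
        (fun y hy => ?_) (fun y hy => ?_)
      all_goals rw [interior_Ioc] at hy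
      · exact (hd y hy.1).differentiableAt.differentiableWithinAt
      · rw [(hd y hy.1).deriv]
        refine div_nonpos_of_nonpos_of_nonneg ?_ (by positivity)
        exact Odd.pow_nonpos (by decide) (by linarith [hy.2])
    exact hanti ⟨hx, h⟩ ⟨zero_lt_one, le_rfl⟩ h

section Pinsker

variable {α : Type*} [Fintype α]

/-- The relative entropy `KL(p ‖ q)` of two mass functions on a finite type. It is the true
divergence only if `q a = 0` implies `p a = 0`. -/
noncomputable def relEntropy (p q : α → ℝ) : ℝ := ∑ a, p a * Real.log (p a / q a)

lemma sq_sub_le_mul_log {p q : ℝ} (hp : 0 ≤ p) (hq : 0 ≤ q) (h : q = 0 → p = 0) :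
    (p - q) ^ 2 ≤ (2 * p + 4 * q) / 3 * (p * Real.log (p / q) - p + q) := by
  rcases hq.eq_or_lt with rfl | hq
  · simp [h rfl]
  rcases hp.eq_or_lt with rfl | hp
  · simp
    nlinarith
  have key := rational_le_log (div_pos hp hq)
  have e : (p / q - 1) * (5 * (p / q) + 1) / (2 * (p / q) * (p / q + 2)) =
      (p - q) * (5 * p + q) / (2 * p * (p + 2 * q)) := by
    field_simp
  rw [e, div_le_iff₀ (by positivity)] at key
  nlinarith

lemma mul_log_div_sub_add_nonneg {p q : ℝ} (hp : 0 ≤ p) (hq : 0 ≤ q) (h : q = 0 → p = 0) :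
    0 ≤ p * Real.log (p / q) - p + q := by
  rcases hq.eq_or_lt with rfl | hq
  · simp [h rfl]
  rcases hp.eq_or_lt with rfl | hp
  · simpa using hq.le
  have := mul_le_mul_of_nonneg_left (Real.one_sub_inv_le_log_of_pos (div_pos hp hq)) hp.le
  have e : p * (1 - (p / q)⁻¹) = p - q := by field_simp
  linarith

/-- **Pinsker's inequality**: the `ℓ¹` distance is at most `√(2 KL)`. -/
lemma sum_abs_sub_sq_le (p q : α → ℝ) (hp : ∀ a, 0 ≤ p a) (hq : ∀ a, 0 ≤ q a)
    (hpq : ∀ a, q a = 0 → p a = 0) (hp1 : ∑ a, p a = 1) (hq1 : ∑ a, q a = 1) :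
    (∑ a, |p a - q a|) ^ 2 ≤ 2 * relEntropy p q := by
  have h := sum_sq_le_sum_mul_sum_of_sq_le_mul (univ : Finset α) (r := fun a => |p a - q a|)
    (f := fun a => (2 * p a + 4 * q a) / 3)
    (g := fun a => p a * Real.log (p a / q a) - p a + q a)
    (fun a _ => by have := hp a; have := hq a; positivity)
    (fun a _ => mul_log_div_sub_add_nonneg (hp a) (hq a) (hpq a))
    (fun a _ => by rw [sq_abs]; exact sq_sub_le_mul_log (hp a) (hq a) (hpq a))
  have e1 : ∑ a, (2 * p a + 4 * q a) / 3 = 2 := by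
    rw [← sum_div, sum_add_distrib, ← mul_sum, ← mul_sum, hp1, hq1]; norm_num
  have e2 : ∑ a, (p a * Real.log (p a / q a) - p a + q a) = relEntropy p q := by
    rw [sum_add_distrib, sum_sub_distrib, hp1, hq1, relEntropy]; ring
  rwa [e1, e2] at h

/-- Pinsker's inequality in dual form: the means of a `[0, C]`-valued function. -/
lemma sum_mul_le_add_sqrt_relEntropy (p q f : α → ℝ) (hp : ∀ a, 0 ≤ p a) (hq : ∀ a, 0 ≤ q a)
    (hpq : ∀ a, q a = 0 → p a = 0) (hp1 : ∑ a, p a = 1) (hq1 : ∑ a, q a = 1) {C D : ℝ}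
    (hf0 : ∀ a, 0 ≤ f a) (hfC : ∀ a, f a ≤ C) (hC : 0 ≤ C) (hD : relEntropy p q ≤ D) :
    ∑ a, q a * f a ≤ ∑ a, p a * f a + C * √(D / 2) := by
  have h1 : ∑ a, q a * f a - ∑ a, p a * f a = ∑ a, (q a - p a) * (f a - C / 2) := by
    simp only [mul_sub, sub_mul, sum_sub_distrib, ← sum_mul, hp1, hq1]; ring
  have h2 : ∑ a, (q a - p a) * (f a - C / 2) ≤ ∑ a, |p a - q a| * (C / 2) := by
    refine sum_le_sum fun a _ => (le_abs_self _).trans ?_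
    rw [abs_mul, abs_sub_comm (q a)]
    refine mul_le_mul_of_nonneg_left ?_ (abs_nonneg _)
    rw [abs_le]; constructor <;> linarith [hf0 a, hfC a]
  have h3 : ∑ a, |p a - q a| ≤ 2 * √(D / 2) := by
    have h4 : (∑ a, |p a - q a|) ^ 2 ≤ 2 * D :=
      (sum_abs_sub_sq_le p q hp hq hpq hp1 hq1).trans (by linarith)
    have h5 : 2 * √(D / 2) = √(2 * D) := by
      rw [show (2 : ℝ) * D = 2 ^ 2 * (D / 2) by ring, Real.sqrt_mul (by norm_num),
        Real.sqrt_sq (by norm_num)]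
    rw [h5]
    exact Real.le_sqrt_of_sq_le h4
  rw [← sum_mul] at h2
  nlinarith

/-- The relative entropy is at most the `χ²` divergence. -/
lemma relEntropy_le_sum_sq_div (p q : α → ℝ) (hp : ∀ a, 0 ≤ p a) (hq : ∀ a, 0 ≤ q a)
    (hpq : ∀ a, q a = 0 → p a = 0) (hp1 : ∑ a, p a = 1) (hq1 : ∑ a, q a = 1) :
    relEntropy p q ≤ ∑ a, (p a - q a) ^ 2 / q a := by
  have h : ∀ a, p a * Real.log (p a / q a) ≤ (p a - q a) ^ 2 / q a + (p a - q a) := by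
    intro a
    rcases (hq a).eq_or_lt with h0 | hq
    · simp [hpq a h0.symm, ← h0]
    rcases (hp a).eq_or_lt with h0 | hp
    · simp [← h0]
      rw [sq, mul_div_cancel_right₀ _ hq.ne']
    · have := mul_le_mul_of_nonneg_left (Real.log_le_sub_one_of_pos (div_pos hp hq)) hp.le
      refine this.trans_eq ?_
      field_simp
      ring
  refine (sum_le_sum fun a _ => h a).trans_eq ?_
  rw [sum_add_distrib, sum_sub_distrib, hp1, hq1]; ring

end Pinsker

/-! ### Laws of finite sequential processes -/

section Path

variable {α β : Type*}

/-- The probability of a path of length `t` of the process on `α` whose next state, given the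
path `h` so far, has the mass function `q t h`. -/
def pathProb (q : (t : ℕ) → (Fin t → α) → α → ℝ) : (t : ℕ) → (Fin t → α) → ℝ
  | 0, _ => 1
  | t + 1, h => pathProb q t (Fin.init h) * q t (Fin.init h) (h (Fin.last t))

lemma pathProb_eq_zero {q q' : (t : ℕ) → (Fin t → α) → α → ℝ}
    (hac : ∀ t h x, q' t h x = 0 → q t h x = 0) :
    ∀ (t : ℕ) (h : Fin t → α), pathProb q' t h = 0 → pathProb q t h = 0
  | 0, _, h0 => by simp [pathProb] at h0
  | t + 1, h, h0 => by
    simp only [pathProb, mul_eq_zero] at h0 ⊢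
    exact h0.imp (pathProb_eq_zero hac t _) (hac _ _ _)

variable [Fintype α] [Fintype β]

/-- A sum over paths of length `t + 1` splits into the first `t` states and the last one. -/
lemma sum_path_succ {t : ℕ} (F : (Fin (t + 1) → α) → ℝ) :
    ∑ h, F h = ∑ h : Fin t → α, ∑ x, F (Fin.snoc (α := fun _ => α) h x) := by
  rw [← (Fin.snocEquiv (fun _ : Fin (t + 1) => α)).sum_comp, Fintype.sum_prod_type_right]
  rfl

lemma sum_pathProb_succ (q : (t : ℕ) → (Fin t → α) → α → ℝ) {t : ℕ}
    (F : (Fin (t + 1) → α) → ℝ) :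
    ∑ h, pathProb q (t + 1) h * F h =
      ∑ h, pathProb q t h * ∑ x, q t h x * F (Fin.snoc (α := fun _ => α) h x) := by
  rw [sum_path_succ]
  refine sum_congr rfl fun h _ => ?_
  rw [mul_sum]
  refine sum_congr rfl fun x _ => ?_
  simp only [pathProb, Fin.init_snoc, Fin.snoc_last]
  ring

/-- The transition mass functions `q` are probability distributions. -/
structure IsTransition (q : (t : ℕ) → (Fin t → α) → α → ℝ) : Prop where
  nonneg : ∀ t h x, 0 ≤ q t h x
  sum_eq_one : ∀ t h, ∑ x, q t h x = 1

variable {q q' : (t : ℕ) → (Fin t → α) → α → ℝ}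

lemma pathProb_nonneg (hq : IsTransition q) : ∀ (t : ℕ) (h : Fin t → α), 0 ≤ pathProb q t h
  | 0, _ => zero_le_one
  | t + 1, _ => mul_nonneg (pathProb_nonneg hq t _) (hq.nonneg _ _ _)

lemma sum_pathProb (hq : IsTransition q) (t : ℕ) : ∑ h, pathProb q t h = 1 := by
  induction t with
  | zero => simp [pathProb]
  | succ t ih =>
    have := sum_pathProb_succ q (t := t) (fun _ => 1)
    simp only [mul_one, hq.sum_eq_one] at this
    rw [this, ih]

lemma sum_pathProb_mul_const (hq : IsTransition q) (t : ℕ) (c : ℝ) :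
    ∑ h, pathProb q t h * c = c := by
  rw [← sum_mul, sum_pathProb hq, one_mul]

/-- The mean of an additive functional advances by the conditional mean of its last term. -/
lemma sum_pathProb_mul_sum_succ (hq : IsTransition q) (f : α → ℝ) (t : ℕ) :
    ∑ h, pathProb q (t + 1) h * ∑ s, f (h s) =
      ∑ h, pathProb q t h * ∑ s, f (h s) + ∑ h, pathProb q t h * ∑ x, q t h x * f x := by
  rw [sum_pathProb_succ, ← sum_add_distrib]
  refine sum_congr rfl fun h _ => ?_
  simp only [Fin.sum_univ_castSucc, Fin.snoc_castSucc, Fin.snoc_last, mul_add, sum_add_distrib,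
    ← sum_mul, hq.sum_eq_one, one_mul]

lemma sum_pathProb_mul_sum_congr (hq : IsTransition q) {f g : α → ℝ}
    (hfg : ∀ t h, ∑ x, q t h x * f x = ∑ x, q t h x * g x) (t : ℕ) :
    ∑ h, pathProb q t h * ∑ s, f (h s) = ∑ h, pathProb q t h * ∑ s, g (h s) := by
  induction t with
  | zero => simp
  | succ t ih => simp only [sum_pathProb_mul_sum_succ hq, ih, hfg]

/-- The chain rule for the relative entropy, as an upper bound: if each step contributes at most
the conditional mean of `f`, then the relative entropy of the path laws is at most the mean of
the sum of `f` along the path. -/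
lemma relEntropy_pathProb_le (hq : IsTransition q)
    (hac : ∀ t h x, q' t h x = 0 → q t h x = 0) {f : α → ℝ}
    (hf : ∀ t h, relEntropy (q t h) (q' t h) ≤ ∑ x, q t h x * f x) (t : ℕ) :
    relEntropy (pathProb q t) (pathProb q' t) ≤ ∑ h, pathProb q t h * ∑ s, f (h s) := by
  induction t with
  | zero => simp [relEntropy, pathProb]
  | succ t ih =>
    rw [sum_pathProb_mul_sum_succ hq]
    have e : relEntropy (pathProb q (t + 1)) (pathProb q' (t + 1)) =
        relEntropy (pathProb q t) (pathProb q' t) +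
          ∑ h, pathProb q t h * relEntropy (q t h) (q' t h) := by
      unfold relEntropy
      rw [sum_pathProb_succ, ← sum_add_distrib]
      refine sum_congr rfl fun h _ => ?_
      simp only [pathProb, Fin.init_snoc, Fin.snoc_last]
      rcases eq_or_ne (pathProb q t h) 0 with h0 | h0
      · simp [h0]
      have h0' : pathProb q' t h ≠ 0 := fun h' => h0 (pathProb_eq_zero hac t h h')
      have : ∀ x, q t h x * Real.log (pathProb q t h * q t h x /
          (pathProb q' t h * q' t h x)) = q t h x * Real.log (pathProb q t h / pathProb q' t h) +
            q t h x * Real.log (q t h x / q' t h x) := by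
        intro x
        rcases eq_or_ne (q t h x) 0 with h1 | h1
        · simp [h1]
        have h1' : q' t h x ≠ 0 := fun h' => h1 (hac t h x h')
        rw [mul_div_mul_comm, Real.log_mul (div_ne_zero h0 h0') (div_ne_zero h1 h1'), mul_add]
      simp only [this, sum_add_distrib, ← sum_mul, hq.sum_eq_one, one_mul, mul_add]
    rw [e]
    exact add_le_add ih (sum_le_sum fun h _ =>
      mul_le_mul_of_nonneg_left (hf t h) (pathProb_nonneg hq t h))

/-- If `φ` carries the transitions `q` to the transitions `r`, then it carries the path law of `q`
to that of `r`. -/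
lemma sum_pathProb_comp [DecidableEq β] {r : (t : ℕ) → (Fin t → β) → β → ℝ} (φ : α → β)
    (hφ : ∀ t h y, ∑ x with φ x = y, q t h x = r t (φ ∘ h) y) (t : ℕ)
    (F : (Fin t → β) → ℝ) :
    ∑ h, pathProb q t h * F (φ ∘ h) = ∑ h, pathProb r t h * F h := by
  induction t with
  | zero =>
    simp only [univ_unique, pathProb, sum_singleton]
    congr 2
    exact Subsingleton.elim _ _
  | succ t ih =>
    rw [sum_pathProb_succ, sum_pathProb_succ, ← ih]
    refine sum_congr rfl fun h _ => ?_
    congr 1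
    rw [← sum_fiberwise (s := univ) (g := φ)]
    refine sum_congr rfl fun y _ => ?_
    rw [← hφ, sum_mul]
    refine sum_congr rfl fun x hx => ?_
    rw [(mem_filter.1 hx).2.symm, ← Fin.comp_snoc]

end Path

/-! ### Counting independent biased bits -/

section Bits

/-- The value `±1` of a bit. -/
def bitSign (b : Bool) : ℝ := if b then 1 else -1

lemma bitSign_not (b : Bool) : bitSign (!b) = -bitSign b := by cases b <;> simp [bitSign]

lemma bitSign_mul_self (b : Bool) : bitSign b * bitSign b = 1 := by cases b <;> simp [bitSign]

lemma abs_bitSign (b : Bool) : |bitSign b| = 1 := by cases b <;> simp [bitSign]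

variable {ι : Type*}

section Flip

variable [DecidableEq ι]

/-- Flipping the bit `l₀`. -/
def flipBit (l₀ : ι) : Equiv.Perm (ι → Bool) :=
  Function.Involutive.toPerm (fun ω => Function.update ω l₀ (!ω l₀)) fun ω => by simp

lemma flipBit_self (l₀ : ι) (ω : ι → Bool) : flipBit l₀ ω l₀ = !ω l₀ :=
  Function.update_self ..

lemma flipBit_of_ne {l l₀ : ι} (h : l ≠ l₀) (ω : ι → Bool) : flipBit l₀ ω l = ω l :=
  Function.update_of_ne h ..

end Flip

variable [Fintype ι]

/-- The law of independent bits, the bit `l` being true with probability `1 / 2 + θ l`. -/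
noncomputable def bitLaw (θ : ι → ℝ) (ω : ι → Bool) : ℝ := ∏ l, (1 / 2 + θ l * bitSign (ω l))

lemma bitLaw_pos {θ : ι → ℝ} (hθ : ∀ l, |θ l| < 1 / 2) (ω : ι → Bool) : 0 < bitLaw θ ω := by
  refine prod_pos fun l _ => ?_
  have h : |θ l * bitSign (ω l)| < 1 / 2 := by rw [abs_mul, abs_bitSign, mul_one]; exact hθ l
  linarith [(abs_lt.1 h).1]

variable [DecidableEq ι]

lemma sum_bitLaw (θ : ι → ℝ) : ∑ ω, bitLaw θ ω = 1 := by
  have h := prod_univ_sum (fun _ : ι => (univ : Finset Bool))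
    (fun l b => 1 / 2 + θ l * bitSign b)
  rw [Fintype.piFinset_univ] at h
  unfold bitLaw
  rw [← h]
  refine prod_eq_one fun l _ => ?_
  simp [bitSign]
  ring

lemma bitLaw_update {θ : ι → ℝ} {l₀ : ι} (h : θ l₀ = 0) (e : ℝ) (ω : ι → Bool) :
    bitLaw (Function.update θ l₀ e) ω = bitLaw θ ω * (1 + 2 * e * bitSign (ω l₀)) := by
  unfold bitLaw
  rw [← mul_prod_erase univ _ (mem_univ l₀), ← mul_prod_erase univ _ (mem_univ l₀)]
  have : ∀ l ∈ univ.erase l₀, 1 / 2 + Function.update θ l₀ e l * bitSign (ω l) =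
      1 / 2 + θ l * bitSign (ω l) := fun l hl => by
    rw [Function.update_of_ne (ne_of_mem_erase hl)]
  rw [prod_congr rfl this, Function.update_self, h]
  ring

lemma bitLaw_flipBit {θ : ι → ℝ} {l₀ : ι} (h : θ l₀ = 0) (ω : ι → Bool) :
    bitLaw θ (flipBit l₀ ω) = bitLaw θ ω := by
  refine prod_congr rfl fun l _ => ?_
  rcases eq_or_ne l l₀ with rfl | hl
  · simp [h]
  · rw [flipBit_of_ne hl]

/-- A fair bit has mean sign zero, conditionally on the other bits. -/
lemma sum_bitLaw_mul_bitSign_mul {θ : ι → ℝ} {l₀ : ι} (h : θ l₀ = 0) (F : (ι → Bool) → ℝ)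
    (hF : ∀ ω, F (flipBit l₀ ω) = F ω) : ∑ ω, bitLaw θ ω * bitSign (ω l₀) * F ω = 0 := by
  have := Equiv.sum_comp (flipBit l₀) (fun ω => bitLaw θ ω * bitSign (ω l₀) * F ω)
  simp only [bitLaw_flipBit h, flipBit_self, bitSign_not, hF, mul_neg, neg_mul,
    sum_neg_distrib] at this
  linarith

/-- The mean sign of the bit `l` is `2 θ l`. -/
lemma sum_bitLaw_mul_bitSign (θ : ι → ℝ) (l : ι) :
    ∑ ω, bitLaw θ ω * bitSign (ω l) = 2 * θ l := by
  have h0 : Function.update θ l 0 l = 0 := Function.update_self ..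
  have h1 : Function.update (Function.update θ l 0) l (θ l) = θ := by simp
  have h2 := bitLaw_update h0 (θ l)
  rw [h1] at h2
  have h3 := sum_bitLaw_mul_bitSign_mul h0 (fun _ => 1) (fun _ => rfl)
  have h4 := sum_bitLaw (Function.update θ l 0)
  have h5 : ∀ ω : ι → Bool, bitLaw θ ω * bitSign (ω l) =
      bitLaw (Function.update θ l 0) ω * bitSign (ω l) * 1 +
        bitLaw (Function.update θ l 0) ω * (2 * θ l) := fun ω => by
    rw [h2]
    linear_combination 2 * θ l * bitLaw (Function.update θ l 0) ω * bitSign_mul_self (ω l)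
  simp only [h5, sum_add_distrib, h3, ← sum_mul, h4]
  ring

/-- Fair bits have uncorrelated signs. -/
lemma sum_bitLaw_mul_sq_sum_bitSign {θ : ι → ℝ} {H : Finset ι} (hH : ∀ l ∈ H, θ l = 0) :
    ∑ ω, bitLaw θ ω * (∑ l ∈ H, bitSign (ω l)) ^ 2 = #H := by
  have h1 : ∀ l ∈ H, ∀ l' ∈ H, ∑ ω, bitLaw θ ω * bitSign (ω l) * bitSign (ω l') =
      if l = l' then 1 else 0 := by
    intro l hl l' _
    split_ifs with h
    · subst h
      simp only [mul_assoc, bitSign_mul_self, mul_one, sum_bitLaw]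
    · exact sum_bitLaw_mul_bitSign_mul (hH l hl) _ fun ω => by rw [flipBit_of_ne (Ne.symm h)]
  have h2 : ∀ ω : ι → Bool, bitLaw θ ω * (∑ l ∈ H, bitSign (ω l)) ^ 2 =
      ∑ l ∈ H, ∑ l' ∈ H, bitLaw θ ω * bitSign (ω l) * bitSign (ω l') := fun ω => by
    rw [sq, sum_mul_sum, mul_sum]
    simp only [mul_sum, mul_assoc]
  simp only [h2]
  rw [sum_comm, sum_congr rfl fun l hl =>
    sum_comm.trans (sum_congr rfl fun l' hl' => h1 l hl l' hl')]
  simp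

lemma bitLaw_comp_swap {θ : ι → ℝ} {l l' : ι} (h : θ l = θ l') (ω : ι → Bool) :
    bitLaw θ (ω ∘ Equiv.swap l l') = bitLaw θ ω := by
  unfold bitLaw
  rw [← Equiv.prod_comp (Equiv.swap l l')]
  refine prod_congr rfl fun k _ => ?_
  have : θ (Equiv.swap l l' k) = θ k := by
    rw [Equiv.swap_apply_def]; split_ifs with h1 h2 <;> simp [*]
  simp [this]

/-- The number of true bits in the set `M`. -/
def trueCount (M : Finset ι) (ω : ι → Bool) : Fin (Fintype.card ι + 1) :=
  ⟨#{l ∈ M | ω l = true}, Nat.lt_succ_of_le (card_le_univ _)⟩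

lemma trueCount_flipBit {M : Finset ι} {l₀ : ι} (h : l₀ ∉ M) (ω : ι → Bool) :
    trueCount M (flipBit l₀ ω) = trueCount M ω := by
  unfold trueCount
  congr 2
  exact filter_congr fun l hl => by rw [flipBit_of_ne (ne_of_mem_of_not_mem hl h)]

lemma trueCount_comp_swap {M : Finset ι} {l l' : ι} (hl : l ∈ M) (hl' : l' ∈ M)
    (ω : ι → Bool) : trueCount M (ω ∘ Equiv.swap l l') = trueCount M ω := by
  unfold trueCount
  congr 1
  refine card_equiv (Equiv.swap l l') fun k => ?_
  have : Equiv.swap l l' k ∈ M ↔ k ∈ M := by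
    rw [Equiv.swap_apply_def]; split_ifs with h1 h2 <;> simp [*]
  simp [this]

/-- The law of the number of true bits in `M`. -/
noncomputable def countLaw (θ : ι → ℝ) (M : Finset ι) (y : Fin (Fintype.card ι + 1)) : ℝ :=
  ∑ ω with trueCount M ω = y, bitLaw θ ω

lemma countLaw_nonneg {θ : ι → ℝ} (hθ : ∀ l, |θ l| < 1 / 2) (M : Finset ι)
    (y : Fin (Fintype.card ι + 1)) : 0 ≤ countLaw θ M y :=
  sum_nonneg fun ω _ => (bitLaw_pos hθ ω).le

lemma sum_countLaw (θ : ι → ℝ) (M : Finset ι) : ∑ y, countLaw θ M y = 1 := by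
  unfold countLaw
  rw [sum_fiberwise, sum_bitLaw]

lemma countLaw_eq_zero {θ θ' : ι → ℝ} (hθ : ∀ l, |θ l| < 1 / 2) {M : Finset ι}
    {y : Fin (Fintype.card ι + 1)} (h : countLaw θ M y = 0) : countLaw θ' M y = 0 := by
  refine sum_eq_zero fun ω hω => absurd h (ne_of_gt ?_)
  exact sum_pos (fun ω _ => bitLaw_pos hθ ω) ⟨ω, hω⟩

lemma countLaw_update_sub {θ : ι → ℝ} {l₀ : ι} (h : θ l₀ = 0) (e : ℝ) (M : Finset ι)
    (y : Fin (Fintype.card ι + 1)) :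
    countLaw (Function.update θ l₀ e) M y - countLaw θ M y =
      2 * e * ∑ ω with trueCount M ω = y, bitLaw θ ω * bitSign (ω l₀) := by
  unfold countLaw
  rw [← sum_sub_distrib, mul_sum]
  exact sum_congr rfl fun ω _ => by rw [bitLaw_update h]; ring

lemma countLaw_update_of_notMem {θ : ι → ℝ} {l₀ : ι} (h : θ l₀ = 0) (e : ℝ) {M : Finset ι}
    (hM : l₀ ∉ M) : countLaw (Function.update θ l₀ e) M = countLaw θ M := by
  funext y
  rw [← sub_eq_zero, countLaw_update_sub h]
  have := sum_bitLaw_mul_bitSign_mul h (fun ω => if trueCount M ω = y then 1 else 0)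
    (fun ω => by rw [trueCount_flipBit hM])
  rw [sum_filter]
  simp only [mul_ite, mul_one, mul_zero] at this
  rw [this, mul_zero]

/-- Given the number of true bits, the fair bits that are counted are exchangeable, so each of
them has the same conditional mean sign. -/
lemma sum_filter_bitSign_eq_avg {θ : ι → ℝ} {M H : Finset ι} (hHM : H ⊆ M)
    (hH : ∀ l ∈ H, θ l = 0) {l₀ : ι} (hl₀ : l₀ ∈ H) (y : Fin (Fintype.card ι + 1)) :
    ∑ ω with trueCount M ω = y, bitLaw θ ω * bitSign (ω l₀) =
      ∑ ω with trueCount M ω = y, bitLaw θ ω * ((∑ l ∈ H, bitSign (ω l)) / #H) := by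
  have h1 : ∀ l ∈ H, ∑ ω with trueCount M ω = y, bitLaw θ ω * bitSign (ω l) =
      ∑ ω with trueCount M ω = y, bitLaw θ ω * bitSign (ω l₀) := by
    intro l hl
    rw [sum_filter, sum_filter, ← ((Equiv.swap l l₀).arrowCongr (Equiv.refl Bool)).sum_comp]
    refine sum_congr rfl fun ω _ => ?_
    have e : (Equiv.swap l l₀).arrowCongr (Equiv.refl Bool) ω = ω ∘ Equiv.swap l l₀ := by
      funext k; simp [Equiv.arrowCongr]
    rw [e, trueCount_comp_swap (hHM hl) (hHM hl₀),
      bitLaw_comp_swap ((hH l hl).trans (hH l₀ hl₀).symm)]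
    simp
  have hc : (#H : ℝ) ≠ 0 := by exact_mod_cast (card_pos.2 ⟨l₀, hl₀⟩).ne'
  have h2 := sum_congr rfl h1
  rw [sum_const, nsmul_eq_mul, sum_comm] at h2
  rw [← mul_right_inj' hc, ← h2, mul_sum]
  refine sum_congr rfl fun ω _ => ?_
  rw [← mul_sum]
  field_simp

/-- Changing the bias of one fair bit by `e` changes the law of the count by at most
`4 e² / #H` in `χ²` divergence, where `H` is a set of fair bits that take part in the count: the
score of the change, projected on the count, is the mean sign of the bits of `H`. -/
lemma sum_sq_countLaw_update_sub_div_le {θ : ι → ℝ} (hθ : ∀ l, |θ l| < 1 / 2)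
    {M H : Finset ι} (hHM : H ⊆ M) (hH : ∀ l ∈ H, θ l = 0) {l₀ : ι} (hl₀ : l₀ ∈ H) (e : ℝ) :
    ∑ y, (countLaw (Function.update θ l₀ e) M y - countLaw θ M y) ^ 2 / countLaw θ M y ≤
      4 * e ^ 2 / #H := by
  have h1 : ∀ y, (countLaw (Function.update θ l₀ e) M y - countLaw θ M y) ^ 2 /
      countLaw θ M y ≤ ∑ ω with trueCount M ω = y,
        bitLaw θ ω * (2 * e * ((∑ l ∈ H, bitSign (ω l)) / #H)) ^ 2 := by
    intro y
    have hn : 0 ≤ ∑ ω with trueCount M ω = y,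
        bitLaw θ ω * (2 * e * ((∑ l ∈ H, bitSign (ω l)) / #H)) ^ 2 :=
      sum_nonneg fun ω _ => mul_nonneg (bitLaw_pos hθ ω).le (sq_nonneg _)
    refine div_le_of_le_mul₀ (countLaw_nonneg hθ M y) hn ?_
    rw [countLaw_update_sub (hH l₀ hl₀), sum_filter_bitSign_eq_avg hHM hH hl₀, mul_sum, mul_comm (∑ ω with _, _)]
    refine sum_sq_le_sum_mul_sum_of_sq_le_mul _ (fun ω _ => (bitLaw_pos hθ ω).le)
      (fun ω _ => mul_nonneg (bitLaw_pos hθ ω).le (sq_nonneg _)) fun ω _ => le_of_eq ?_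
    ring
  refine (sum_le_sum fun y _ => h1 y).trans_eq ?_
  rw [sum_fiberwise]
  have hc : (#H : ℝ) ≠ 0 := by exact_mod_cast (card_pos.2 ⟨l₀, hl₀⟩).ne'
  have h2 : ∀ ω : ι → Bool, bitLaw θ ω * (2 * e * ((∑ l ∈ H, bitSign (ω l)) / #H)) ^ 2 =
      4 * e ^ 2 / #H ^ 2 * (bitLaw θ ω * (∑ l ∈ H, bitSign (ω l)) ^ 2) := fun ω => by
    field_simp
    ring
  simp only [h2]
  rw [← mul_sum, sum_bitLaw_mul_sq_sum_bitSign hH]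
  field_simp

end Bits

/-! ### Play against an oblivious adversary -/

section Play

variable {d : ℕ} {A : Finset (Fin d → ℝ)}

/-- The adversary that plays the fixed sequence `z` of loss vectors. -/
def obliviousAdversary (z : ℕ → LossVector d) : Adversary A where
  next t _ := z t
  measurable_next _ := measurable_const

/-- The full bandit feedback, including the player's own distributions, as a function of the
actions and the incurred losses alone. -/
def feedbackHistory (σ : BanditStrategy A) : (t : ℕ) → (Fin t → A × ℝ) → (Fin t → BanditRound A)
  | 0, _ => Fin.elim0
  | t + 1, h =>
    Fin.snoc (α := fun _ => BanditRound A) (feedbackHistory σ t (Fin.init h))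
      (σ.next t (feedbackHistory σ t (Fin.init h)), (h (Fin.last t)).1, (h (Fin.last t)).2)

/-- The player's next distribution as a function of the past actions and losses. -/
def policy (σ : BanditStrategy A) (t : ℕ) (h : Fin t → A × ℝ) : A → ℝ :=
  (σ.next t (feedbackHistory σ t h) : A → ℝ)

lemma policy_nonneg (σ : BanditStrategy A) (t : ℕ) (h : Fin t → A × ℝ) (a : A) :
    0 ≤ policy σ t h a := (σ.next t _).2.1 a

lemma sum_policy (σ : BanditStrategy A) (t : ℕ) (h : Fin t → A × ℝ) :
    ∑ a, policy σ t h a = 1 := (σ.next t _).2.2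

lemma banditFeedback_transcript (σ : BanditStrategy A) (z : ℕ → LossVector d) :
    ∀ (t : ℕ) (a : Fin t → A),
      (fun s => banditFeedback (transcript σ (obliviousAdversary z) t a s)) =
        feedbackHistory σ t (fun s => (a s, loss (a s) (z s)))
  | 0, _ => Subsingleton.elim _ _
  | t + 1, a => by
    have ih := banditFeedback_transcript σ z t (Fin.init a)
    funext s
    refine Fin.lastCases ?_ (fun s => ?_) s
    · simp only [transcript, feedbackHistory, Fin.snoc_last, banditFeedback]
      refine Prod.ext ?_ rfl
      exact congrArg (σ.next t) ih
    · simp only [transcript, feedbackHistory, Fin.snoc_castSucc]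
      exact congrFun ih s

lemma transcript_snd (σ : BanditStrategy A) (z : ℕ → LossVector d) :
    ∀ (t : ℕ) (a : Fin t → A) (s : Fin t),
      (transcript σ (obliviousAdversary z) t a s).2 = (a s, z s)
  | 0, _, s => s.elim0
  | t + 1, a, s => by
    refine Fin.lastCases ?_ (fun s => ?_) s
    · simp [transcript, obliviousAdversary]
    · simp only [transcript, Fin.snoc_castSucc]
      exact transcript_snd σ z t (Fin.init a) s

lemma playProb_succ (σ : BanditStrategy A) (z : ℕ → LossVector d) (t : ℕ)
    (a : Fin (t + 1) → A) :
    playProb σ (obliviousAdversary z) (t + 1) a =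
      playProb σ (obliviousAdversary z) t (Fin.init a) *
        policy σ t (fun s => (Fin.init a s, loss (Fin.init a s : A) (z s))) (a (Fin.last t)) := by
  rw [playProb, Fin.prod_univ_castSucc, policy, ← banditFeedback_transcript]
  simp only [transcript, Fin.snoc_castSucc, Fin.snoc_last]
  rfl

variable {Y : Type*}

/-- The transitions of the process of pairs of an action and a state of `Y`, where the state has
the law `K a` given the action `a`, and the incurred loss is `o a y`. -/
def playTransition (σ : BanditStrategy A) (o K : A → Y → ℝ) (t : ℕ) (h : Fin t → A × Y)
    (x : A × Y) : ℝ :=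
  policy σ t (fun s => ((h s).1, o (h s).1 (h s).2)) x.1 * K x.1 x.2

/-- Against an oblivious adversary whose loss vectors are drawn independently before the game,
the states of the environment and the actions form the process `playTransition`. -/
lemma prod_mul_playProb (σ : BanditStrategy A) (Z : Y → LossVector d) (w : Y → ℝ) :
    ∀ (n : ℕ) (z : ℕ → LossVector d) (a : Fin n → A) (ω : Fin n → Y), (∀ t : Fin n, z t = Z (ω t)) →
      (∏ t, w (ω t)) * playProb σ (obliviousAdversary z) n a =
        pathProb (playTransition σ (fun a y => loss a (Z y)) (fun _ => w)) n
          (fun t => (a t, ω t))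
  | 0, _, _, _, _ => by simp [playProb, pathProb]
  | n + 1, z, a, ω, hz => by
    have ih := prod_mul_playProb σ Z w n z (Fin.init a) (Fin.init ω) fun t => hz t.castSucc
    have e : Fin.init (fun t => (a t, ω t)) = fun t => (Fin.init a t, Fin.init ω t) := rfl
    rw [pathProb, e, ← ih, playProb_succ, Fin.prod_univ_castSucc]
    have e2 : (fun s : Fin n => (Fin.init a s, loss (Fin.init a s : A) (z s))) =
        fun s => (Fin.init a s, loss (Fin.init a s : A) (Z (Fin.init ω s))) := by
      funext s
      rw [show z s = Z (Fin.init ω s) from hz s.castSucc]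
    rw [e2]
    simp only [playTransition, Fin.init]
    ring

variable [Fintype Y]

lemma sum_playTransition (σ : BanditStrategy A) (o K : A → Y → ℝ) (hK : ∀ a, ∑ y, K a y = 1)
    (t : ℕ) (h : Fin t → A × Y) (f : A → ℝ) :
    ∑ x, playTransition σ o K t h x * f x.1 =
      ∑ a, policy σ t (fun s => ((h s).1, o (h s).1 (h s).2)) a * f a := by
  rw [Fintype.sum_prod_type]
  refine sum_congr rfl fun a _ => ?_
  simp only [playTransition]
  rw [← sum_mul, ← mul_sum, hK, mul_one]

lemma isTransition_playTransition (σ : BanditStrategy A) {o K : A → Y → ℝ}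
    (hK0 : ∀ a y, 0 ≤ K a y) (hK : ∀ a, ∑ y, K a y = 1) :
    IsTransition (playTransition σ o K) where
  nonneg _ _ _ := mul_nonneg (policy_nonneg _ _ _ _) (hK0 _ _)
  sum_eq_one t h := by
    have := sum_playTransition σ o K hK t h fun _ => 1
    simpa only [mul_one, sum_policy] using this

/-- Only the laws of the observations contribute to the relative entropy of one round. -/
lemma relEntropy_playTransition (σ : BanditStrategy A) {o K K' : A → Y → ℝ} (t : ℕ)
    (h : Fin t → A × Y) :
    relEntropy (playTransition σ o K t h) (playTransition σ o K' t h) =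
      ∑ a, policy σ t (fun s => ((h s).1, o (h s).1 (h s).2)) a * relEntropy (K a) (K' a) := by
  unfold relEntropy playTransition
  rw [Fintype.sum_prod_type]
  refine sum_congr rfl fun a _ => ?_
  rw [mul_sum]
  refine sum_congr rfl fun y _ => ?_
  set w := policy σ t (fun s => ((h s).1, o (h s).1 (h s).2)) a
  rcases eq_or_ne w 0 with h0 | h0
  · simp [h0]
  · rw [mul_div_mul_left _ _ h0, mul_assoc]

/-- If the loss vectors are drawn independently, then for some outcome the regret is at least the
mean excess loss of the player over any fixed action `b`. -/
lemma exists_le_regret (hA : A.Nonempty) (σ : BanditStrategy A) (Z : Y → LossVector d)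
    {w : Y → ℝ} (hw : ∀ y, 0 < w y) (hw1 : ∑ y, w y = 1) (n : ℕ) {b : Fin d → ℝ}
    (hb : b ∈ A) :
    ∃ τ : Adversary A,
      ∑ h, pathProb (playTransition σ (fun a y => loss a (Z y)) (fun _ => w)) n h *
        ∑ t, (loss (h t).1 (Z (h t).2) - loss b (Z (h t).2)) ≤ regret hA σ τ n := by
  classical
  set V := ∑ h, pathProb (playTransition σ (fun a y => loss a (Z y)) (fun _ => w)) n h *
        ∑ t, (loss (h t).1 (Z (h t).2) - loss b (Z (h t).2)) with hV
  have hne : Nonempty Y := by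
    by_contra hY
    rw [not_nonempty_iff] at hY
    simp at hw1
  let z : (Fin n → Y) → ℕ → LossVector d := fun ω t =>
    if h : t < n then Z (ω ⟨t, h⟩) else fun _ => 0
  have hz : ∀ ω (t : Fin n), z ω t = Z (ω t) := fun ω t => by simp [z]
  have hW : ∑ ω : Fin n → Y, ∏ t, w (ω t) = 1 := by
    have h := prod_univ_sum (fun _ : Fin n => (univ : Finset Y)) (fun _ y => w y)
    rw [Fintype.piFinset_univ] at h
    rw [← h]
    simp [hw1]
  have hreg : ∀ ω, ∑ a : Fin n → A, playProb σ (obliviousAdversary (z ω)) n a *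
      ∑ t, (loss (a t) (Z (ω t)) - loss b (Z (ω t))) ≤
        regret hA σ (obliviousAdversary (z ω)) n := by
    intro ω
    have h1 := inf'_le (fun b => expectation σ (obliviousAdversary (z ω)) n
      (fun h => ∑ t, loss b (h t).2.2)) hb
    refine le_trans (le_of_eq ?_) (sub_le_sub_left h1 _)
    simp only [expectation, transcript_snd, hz]
    rw [← sum_sub_distrib]
    simp only [sum_sub_distrib, mul_sub]
  have hsum : ∑ ω : Fin n → Y, (∏ t, w (ω t)) * V ≤
      ∑ ω : Fin n → Y, (∏ t, w (ω t)) * regret hA σ (obliviousAdversary (z ω)) n := by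
    rw [← sum_mul, hW, one_mul]
    refine le_trans (le_of_eq ?_) (sum_le_sum fun ω _ =>
      mul_le_mul_of_nonneg_left (hreg ω) (prod_nonneg fun t _ => (hw _).le))
    rw [hV, ← (Equiv.arrowProdEquivProdArrow (Fin n) (fun _ => A) (fun _ => Y)).symm.sum_comp,
      Fintype.sum_prod_type_right]
    refine sum_congr rfl fun ω _ => ?_
    rw [mul_sum]
    refine sum_congr rfl fun a _ => ?_
    rw [← mul_assoc, prod_mul_playProb σ Z w n (z ω) a ω (hz ω)]
    rfl
  obtain ⟨ω, -, hω⟩ := exists_le_of_sum_le univ_nonempty hsum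
  exact ⟨_, le_of_mul_le_mul_left hω (prod_pos fun t _ => hw _)⟩

end Play

/-! ### The action set: one coordinate from each block -/

section Blocks

variable {m d : ℕ} (blk : Fin d → Fin m)

/-- A choice of one coordinate from each of the blocks `{x | blk x = i}`. -/
abbrev BlockSection : Type := (i : Fin m) → {x : Fin d // blk x = i}

variable {blk}

/-- The indicator vector of the coordinates chosen by `J`. -/
def indicator (J : BlockSection blk) (x : Fin d) : ℝ := if (J (blk x) : Fin d) = x then 1 else 0

variable (blk) in
/-- The indicator vectors that have exactly one nonzero coordinate in each block. -/
noncomputable def blockActions : Finset (Fin d → ℝ) :=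
  univ.image (indicator : BlockSection blk → Fin d → ℝ)

lemma indicator_mem (J : BlockSection blk) : indicator J ∈ blockActions blk :=
  mem_image_of_mem _ (mem_univ J)

lemma exists_eq_indicator {a : Fin d → ℝ} (ha : a ∈ blockActions blk) :
    ∃ J : BlockSection blk, a = indicator J := by
  obtain ⟨J, -, rfl⟩ := mem_image.1 ha
  exact ⟨J, rfl⟩

lemma action_eq_zero_or_one {a : Fin d → ℝ} (ha : a ∈ blockActions blk) (x : Fin d) :
    a x = 0 ∨ a x = 1 := by
  obtain ⟨J, rfl⟩ := exists_eq_indicator ha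
  unfold indicator
  split_ifs <;> simp

lemma action_nonneg {a : Fin d → ℝ} (ha : a ∈ blockActions blk) (x : Fin d) : 0 ≤ a x := by
  rcases action_eq_zero_or_one ha x with h | h <;> simp [h]

lemma action_le_one {a : Fin d → ℝ} (ha : a ∈ blockActions blk) (x : Fin d) : a x ≤ 1 := by
  rcases action_eq_zero_or_one ha x with h | h <;> simp [h]

lemma coe_section_block (J : BlockSection blk) (i : Fin m) :
    (J (blk (J i)) : Fin d) = J i := by
  have h : ∀ j, j = i → (J j : Fin d) = J i := by rintro _ rfl; rfl
  exact h _ (J i).2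

lemma sum_block_indicator_mul (J : BlockSection blk) (g : Fin d → ℝ) (i : Fin m) :
    ∑ x : {x // blk x = i}, indicator J x * g x = g (J i) := by
  rw [sum_eq_single (J i)]
  · simp [indicator, coe_section_block]
  · rintro ⟨x, rfl⟩ - hx
    have : (J (blk x) : Fin d) ≠ x := fun h => hx (Subtype.ext h.symm)
    simp [indicator, this]
  · simp

lemma sum_indicator_mul (J : BlockSection blk) (g : Fin d → ℝ) :
    ∑ x, indicator J x * g x = ∑ i, g (J i) := by
  rw [← (Equiv.sigmaFiberEquiv blk).sum_comp, Fintype.sum_sigma]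
  exact sum_congr rfl fun i _ => sum_block_indicator_mul J g i

lemma sum_block_action {a : Fin d → ℝ} (ha : a ∈ blockActions blk) (i : Fin m) :
    ∑ x : {x // blk x = i}, a x = 1 := by
  obtain ⟨J, rfl⟩ := exists_eq_indicator ha
  simpa using sum_block_indicator_mul J (fun _ => 1) i

lemma sum_action {a : Fin d → ℝ} (ha : a ∈ blockActions blk) : ∑ x, a x = m := by
  obtain ⟨J, rfl⟩ := exists_eq_indicator ha
  simpa using sum_indicator_mul J (fun _ => 1)

/-- Redrawing the choice in block `i` uniformly does not change an average over all choices. -/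
lemma card_mul_sum_section (i : Fin m) (F : BlockSection blk → ℝ) :
    Fintype.card {x // blk x = i} * ∑ J, F J =
      ∑ J, ∑ x : {x // blk x = i}, F (Function.update J i x) := by
  -- Exchanging the old and the new choice is an involution of the pairs `(J, x)`.
  let T : BlockSection blk × {x // blk x = i} → BlockSection blk × {x // blk x = i} :=
    fun p => (Function.update p.1 i p.2, p.1 i)
  have hT : Function.Involutive T := fun p => by simp [T]
  have h := Equiv.sum_comp hT.toPerm (fun p => F p.1)
  rw [Fintype.sum_prod_type, Fintype.sum_prod_type] at h
  refine Eq.trans ?_ h.symm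
  simp [mul_sum]

/-! ### The random losses -/

/-- The biases of the bits behind the loss vectors: the `m` shared bits and the bits of the
coordinates chosen by `J` are fair, those of the other coordinates are biased by `e`. -/
def bias (J : BlockSection blk) (e : ℝ) : Fin m ⊕ Fin d → ℝ :=
  Sum.elim (fun _ => 0) (fun x => if (J (blk x) : Fin d) = x then 0 else e)

lemma bias_inr (J : BlockSection blk) (e : ℝ) (i : Fin m) : bias J e (Sum.inr (J i)) = 0 := by
  simp [bias, coe_section_block]

lemma abs_bias_lt (J : BlockSection blk) {e : ℝ} (he : |e| < 1 / 2) (l : Fin m ⊕ Fin d) :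
    |bias J e l| < 1 / 2 := by
  rcases l with l | x
  · simp [bias]
  · simp only [bias, Sum.elim_inr]
    split_ifs
    · simp
    · exact he

/-- The biases when no coordinate of block `i` is preferred. -/
def biasWithout (J : BlockSection blk) (e : ℝ) (i : Fin m) : Fin m ⊕ Fin d → ℝ :=
  Function.update (bias J e) (Sum.inr (J i : Fin d)) e

lemma abs_biasWithout_lt (J : BlockSection blk) {e : ℝ} (he : |e| < 1 / 2) (i : Fin m)
    (l : Fin m ⊕ Fin d) : |biasWithout J e i l| < 1 / 2 := by
  unfold biasWithout
  rw [Function.update_apply]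
  split_ifs
  · exact he
  · exact abs_bias_lt J he l

lemma biasWithout_update (J : BlockSection blk) (e : ℝ) (i : Fin m) (x : {x // blk x = i}) :
    biasWithout (Function.update J i x) e i = biasWithout J e i := by
  funext l
  rcases l with l | y
  · simp [biasWithout, bias]
  · rcases eq_or_ne (blk y) i with rfl | h
    · have h1 : ∀ z : Fin d, (if y = z then e else if z = y then 0 else e) = e := fun z => by
        split_ifs with h h' <;> simp_all
      simp [biasWithout, bias, Function.update_apply, h1]
    · have h1 : y ≠ x := fun hy => h (hy ▸ x.2)
      have h2 : y ≠ (J i : Fin d) := fun hy => h (hy ▸ (J i).2)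
      simp [biasWithout, bias, h, h1, h2]

lemma bit_eq (b : Bool) : (if b then 1 else 0 : ℝ) = (1 + bitSign b) / 2 := by
  cases b <;> simp [bitSign]

/-- The loss vector made from the bits `ω`: each coordinate is the mean of its own bit and of the
average of the `m` shared bits. The shared bits are noise that hides the contributions of the
individual coordinates to the incurred loss. -/
noncomputable def noisyLoss (ω : Fin m ⊕ Fin d → Bool) : LossVector d := fun x =>
  ⟨((∑ l, (if ω (Sum.inl l) then 1 else 0 : ℝ)) / m + if ω (Sum.inr x) then 1 else 0) / 2, by
    have h0 : (0 : ℝ) ≤ ∑ l : Fin m, (if ω (Sum.inl l) then 1 else 0 : ℝ) :=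
      sum_nonneg fun l _ => by split_ifs <;> norm_num
    have h1 : ∑ l : Fin m, (if ω (Sum.inl l) then 1 else 0 : ℝ) ≤ m := by
      refine (sum_le_card_nsmul univ _ 1 fun l _ => ?_).trans_eq (by simp)
      split_ifs <;> norm_num
    have h2 := div_nonneg h0 (Nat.cast_nonneg (α := ℝ) m)
    have h3 := div_le_one_of_le₀ h1 (Nat.cast_nonneg (α := ℝ) m)
    constructor <;> split_ifs <;> linarith⟩

/-- The bits that contribute to the loss incurred by the action `a`. -/
noncomputable def countedBits (a : Fin d → ℝ) : Finset (Fin m ⊕ Fin d) :=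
  univ.disjSum {x | a x = 1}

lemma loss_noisyLoss (hm : 0 < m) {a : Fin d → ℝ} (ha : a ∈ blockActions blk)
    (ω : Fin m ⊕ Fin d → Bool) :
    loss a (noisyLoss ω) = (trueCount (countedBits (m := m) a) ω : ℕ) / 2 := by
  have hm' : (m : ℝ) ≠ 0 := by exact_mod_cast hm.ne'
  have h1 : ∑ x, a x * (if ω (Sum.inr x) then 1 else 0 : ℝ) =
      ∑ x with a x = 1, (if ω (Sum.inr x) then 1 else 0 : ℝ) := by
    rw [sum_filter]
    refine sum_congr rfl fun x _ => ?_
    rcases action_eq_zero_or_one ha x with h | h <;> simp [h]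
  have h2 : ((trueCount (countedBits (m := m) a) ω : ℕ) : ℝ) =
      ∑ l : Fin m, (if ω (Sum.inl l) then 1 else 0 : ℝ) +
        ∑ x with a x = 1, (if ω (Sum.inr x) then 1 else 0 : ℝ) := by
    simp only [trueCount, card_filter, countedBits, sum_disjSum]
    push_cast
    rfl
  rw [h2, ← h1]
  simp only [loss, noisyLoss, ← mul_div_assoc, mul_add, add_div, sum_add_distrib, ← sum_mul,
    ← sum_div, sum_action ha]
  field_simp

/-- The mean excess loss of the action `a` over the action chosen by `J` in one round. -/
lemma sum_bitLaw_mul_loss_sub {a : Fin d → ℝ} (ha : a ∈ blockActions blk)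
    (J : BlockSection blk) (e : ℝ) :
    ∑ ω, bitLaw (bias J e) ω * (loss a (noisyLoss ω) - loss (indicator J) (noisyLoss ω)) =
      e / 2 * (m - ∑ i, a (J i)) := by
  have h1 : ∀ ω : Fin m ⊕ Fin d → Bool,
      loss a (noisyLoss ω) - loss (indicator J) (noisyLoss ω) =
        ∑ x, (a x - indicator J x) / 4 * bitSign (ω (Sum.inr x)) := by
    intro ω
    have hs : ∑ x, (a x - indicator J x) = 0 := by
      rw [sum_sub_distrib, sum_action ha, sum_action (indicator_mem J), sub_self]
    set c := (∑ l : Fin m, (if ω (Sum.inl l) then 1 else 0 : ℝ)) / m with hc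
    have : loss a (noisyLoss ω) - loss (indicator J) (noisyLoss ω) =
        ∑ x, ((a x - indicator J x) * (c / 2 + 1 / 4) +
          (a x - indicator J x) / 4 * bitSign (ω (Sum.inr x))) := by
      unfold loss
      rw [← sum_sub_distrib]
      refine sum_congr rfl fun x _ => ?_
      simp only [noisyLoss, ← hc, bit_eq (ω (Sum.inr x))]
      ring
    rw [this, sum_add_distrib, ← sum_mul, hs, zero_mul, zero_add]
  simp only [h1, mul_sum]
  rw [sum_comm]
  have h2 : ∀ x : Fin d, ∑ ω, bitLaw (bias J e) ω *
      ((a x - indicator J x) / 4 * bitSign (ω (Sum.inr x))) =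
        e / 2 * (a x - indicator J x * a x) := by
    intro x
    have h3 : ∀ ω : Fin m ⊕ Fin d → Bool, bitLaw (bias J e) ω *
        ((a x - indicator J x) / 4 * bitSign (ω (Sum.inr x))) =
          (a x - indicator J x) / 4 * (bitLaw (bias J e) ω * bitSign (ω (Sum.inr x))) :=
      fun ω => by ring
    simp only [h3]
    rw [← mul_sum, sum_bitLaw_mul_bitSign]
    simp only [bias, indicator, Sum.elim_inr]
    split_ifs <;> ring
  simp only [h2]
  rw [← mul_sum, sum_sub_distrib, sum_action ha, sum_indicator_mul]

lemma sum_abs_action {a : Fin d → ℝ} (ha : a ∈ blockActions blk) : ∑ x, |a x| = m := by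
  rw [← sum_action ha]
  exact sum_congr rfl fun x _ => abs_of_nonneg (action_nonneg ha x)

end Blocks

/-! ### The preferred coordinates are hard to find -/

section LowerBound

variable {m d : ℕ} {blk : Fin d → Fin m}

/-- The transitions of the process of actions and observed bit counts when the bits have the
biases `θ`; the incurred loss is half of the count. -/
noncomputable def countTransition (σ : BanditStrategy (blockActions blk))
    (θ : Fin m ⊕ Fin d → ℝ) :
    (t : ℕ) → (Fin t → blockActions blk × Fin (Fintype.card (Fin m ⊕ Fin d) + 1)) →
      blockActions blk × Fin (Fintype.card (Fin m ⊕ Fin d) + 1) → ℝ :=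
  playTransition σ (fun _ y => ((y : ℕ) : ℝ) / 2) (fun a y => countLaw θ (countedBits a) y)

lemma isTransition_countTransition (σ : BanditStrategy (blockActions blk))
    {θ : Fin m ⊕ Fin d → ℝ} (hθ : ∀ l, |θ l| < 1 / 2) :
    IsTransition (countTransition σ θ) :=
  isTransition_playTransition σ (fun _ _ => countLaw_nonneg hθ _ _) (fun _ => sum_countLaw _ _)

/-- The expected number of rounds among the first `n` whose action contains the coordinate `x`. -/
noncomputable def expectedCount (σ : BanditStrategy (blockActions blk))
    (θ : Fin m ⊕ Fin d → ℝ) (n : ℕ) (x : Fin d) : ℝ :=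
  ∑ h, pathProb (countTransition σ θ) n h * ∑ t, ((h t).1 : Fin d → ℝ) x

lemma expectedCount_nonneg (σ : BanditStrategy (blockActions blk)) {θ : Fin m ⊕ Fin d → ℝ}
    (hθ : ∀ l, |θ l| < 1 / 2) (n : ℕ) (x : Fin d) : 0 ≤ expectedCount σ θ n x :=
  sum_nonneg fun _ _ => mul_nonneg (pathProb_nonneg (isTransition_countTransition σ hθ) _ _)
    (sum_nonneg fun _ _ => action_nonneg (Subtype.prop _) _)

lemma sum_block_expectedCount (σ : BanditStrategy (blockActions blk)) {θ : Fin m ⊕ Fin d → ℝ}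
    (hθ : ∀ l, |θ l| < 1 / 2) (n : ℕ) (i : Fin m) :
    ∑ x : {x // blk x = i}, expectedCount σ θ n x = n := by
  unfold expectedCount
  rw [sum_comm]
  refine Eq.trans (sum_congr rfl fun h _ => ?_)
    (sum_pathProb_mul_const (isTransition_countTransition σ hθ) n (n : ℝ))
  rw [← mul_sum, sum_comm]
  simp only [sum_block_action (Subtype.prop _), sum_const, card_univ, Fintype.card_fin,
    nsmul_eq_mul, mul_one]

/-- Making the coordinate chosen in block `i` preferred raises the number of its selections only
as far as the information collected by selecting it allows. -/
lemma expectedCount_bias_le (σ : BanditStrategy (blockActions blk)) (J : BlockSection blk)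
    {e : ℝ} (he : |e| < 1 / 2) (i : Fin m) (n : ℕ) :
    expectedCount σ (bias J e) n (J i) ≤ expectedCount σ (biasWithout J e i) n (J i) +
      n * √(4 * e ^ 2 / (m + 1) * expectedCount σ (biasWithout J e i) n (J i) / 2) := by
  have hθ := abs_bias_lt J he
  have hθ' := abs_biasWithout_lt J he i
  have hq := isTransition_countTransition σ hθ
  have hq' := isTransition_countTransition σ hθ'
  have hac : ∀ t h x, countTransition σ (bias J e) t h x = 0 →
      countTransition σ (biasWithout J e i) t h x = 0 := by
    intro t h x h0
    simp only [countTransition, playTransition, mul_eq_zero] at h0 ⊢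
    exact h0.imp_right (countLaw_eq_zero hθ)
  refine sum_mul_le_add_sqrt_relEntropy (pathProb (countTransition σ (biasWithout J e i)) n)
    (pathProb (countTransition σ (bias J e)) n) _ (pathProb_nonneg hq' n) (pathProb_nonneg hq n)
    (pathProb_eq_zero hac n) (sum_pathProb hq' n) (sum_pathProb hq n)
    (fun h => sum_nonneg fun _ _ => action_nonneg (Subtype.prop _) _) (fun h => ?_)
    (Nat.cast_nonneg n) ?_
  · refine (sum_le_card_nsmul univ _ 1 fun t _ => action_le_one (Subtype.prop _) _).trans_eq ?_
    simp
  · have hstep : ∀ a : blockActions blk,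
        relEntropy (countLaw (biasWithout J e i) (countedBits (a : Fin d → ℝ)))
          (countLaw (bias J e) (countedBits (a : Fin d → ℝ))) ≤
            4 * e ^ 2 / (m + 1) * (a : Fin d → ℝ) (J i) := by
      intro a
      rcases action_eq_zero_or_one a.2 (J i) with h0 | h1
      · have hn : Sum.inr (J i : Fin d) ∉ countedBits (m := m) (a : Fin d → ℝ) := by
          simp [countedBits, h0]
        rw [biasWithout, countLaw_update_of_notMem (bias_inr J e i) e hn, h0, mul_zero]
        refine le_of_eq (sum_eq_zero fun y _ => ?_)
        rcases eq_or_ne (countLaw (bias J e) (countedBits (a : Fin d → ℝ)) y) 0 with hz | hz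
        · simp [hz]
        · simp [div_self hz]
      · rw [h1, mul_one]
        refine (relEntropy_le_sum_sq_div _ _ (countLaw_nonneg hθ' _) (countLaw_nonneg hθ _)
          (fun y => countLaw_eq_zero hθ) (sum_countLaw _ _) (sum_countLaw _ _)).trans ?_
        -- The shared bits and the bit of the coordinate `J i` are fair and all counted.
        have hH := sum_sq_countLaw_update_sub_div_le hθ
          (M := countedBits (a : Fin d → ℝ)) (H := univ.disjSum {(J i : Fin d)})
          (disjSum_mono_right _ (by simpa using h1))
          (fun l hl => by
            rcases l with l | x
            · rfl
            · have : x = J i := by simpa using hl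
              rw [this, bias_inr])
          (l₀ := Sum.inr (J i : Fin d)) (by simp) e
        rw [card_disjSum, card_univ, Fintype.card_fin, card_singleton] at hH
        push_cast at hH
        exact hH
    have := relEntropy_pathProb_le hq' hac
      (f := fun x => 4 * e ^ 2 / (m + 1) * (x.1 : Fin d → ℝ) (J i)) (fun t h => by
        unfold countTransition
        rw [relEntropy_playTransition]
        refine le_of_le_of_eq (sum_le_sum fun a _ =>
          mul_le_mul_of_nonneg_left (hstep a) (policy_nonneg _ _ _ _)) ?_
        exact (sum_playTransition (Y := Fin (Fintype.card (Fin m ⊕ Fin d) + 1)) σ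
          (fun _ y => ((y : ℕ) : ℝ) / 2)
          (fun a y => countLaw (biasWithout J e i) (countedBits a) y) (fun a => sum_countLaw _ _) t h
          (fun a => 4 * e ^ 2 / (m + 1) * (a : Fin d → ℝ) (J i))).symm) n
    refine this.trans_eq ?_
    rw [expectedCount, mul_sum]
    refine sum_congr rfl fun h _ => ?_
    rw [← mul_sum]
    ring

/-- On average over the preferred coordinates `J`, the player rarely selects the one in
block `i`. -/
lemma sum_section_expectedCount_le (σ : BanditStrategy (blockActions blk)) {e : ℝ}
    (he : |e| < 1 / 2) (n : ℕ) (i : Fin m) {k : ℕ} (hk : Fintype.card {x // blk x = i} = k)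
    (hk0 : 0 < k) :
    ∑ J : BlockSection blk, expectedCount σ (bias J e) n (J i) ≤
      ∑ _J : BlockSection blk, n * (1 / k + √(2 * e ^ 2 * n / ((m + 1) * k))) := by
  have hk' : (0 : ℝ) < k := by exact_mod_cast hk0
  refine le_of_mul_le_mul_left ?_ hk'
  rw [← hk, card_mul_sum_section, hk, mul_sum]
  refine sum_le_sum fun J _ => ?_
  have h1 : ∀ x : {x // blk x = i},
      expectedCount σ (bias (Function.update J i x) e) n (Function.update J i x i) ≤
        expectedCount σ (biasWithout J e i) n x +
          n * (√(2 * e ^ 2 / (m + 1)) * √(expectedCount σ (biasWithout J e i) n x)) := by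
    intro x
    have h := expectedCount_bias_le σ (Function.update J i x) he i n
    rw [biasWithout_update] at h
    rw [← Real.sqrt_mul (by positivity)]
    simp only [Function.update_self] at h ⊢
    refine h.trans_eq ?_
    congr 3
    ring
  refine (sum_le_sum fun x _ => h1 x).trans ?_
  have hθ' := abs_biasWithout_lt J he i
  have h2 : ∑ x : {x // blk x = i}, √(expectedCount σ (biasWithout J e i) n x) ≤ √(k * n) := by
    refine Real.le_sqrt_of_sq_le ?_
    have h := sum_sq_le_sum_mul_sum_of_sq_le_mul (univ : Finset {x // blk x = i})
      (r := fun x => √(expectedCount σ (biasWithout J e i) n x)) (f := fun _ => (1 : ℝ))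
      (g := fun x => expectedCount σ (biasWithout J e i) n x) (fun _ _ => zero_le_one)
      (fun x _ => expectedCount_nonneg σ hθ' n x)
      (fun x _ => by rw [Real.sq_sqrt (expectedCount_nonneg σ hθ' n x), one_mul])
    rw [sum_block_expectedCount σ hθ', sum_const, card_univ, hk] at h
    simpa using h
  rw [sum_add_distrib, sum_block_expectedCount σ hθ', ← mul_sum, ← mul_sum]
  have h3 : (k : ℝ) * √(2 * e ^ 2 * n / ((m + 1) * k)) = √(2 * e ^ 2 / (m + 1)) * √(k * n) := by
    have : 2 * e ^ 2 / (m + 1) * (k * n) = (k : ℝ) ^ 2 * (2 * e ^ 2 * n / ((m + 1) * k)) := by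
      field_simp
    rw [← Real.sqrt_mul (by positivity), this, Real.sqrt_mul (by positivity),
      Real.sqrt_sq hk'.le]
  have h4 : (k : ℝ) * (n * (1 / k + √(2 * e ^ 2 * n / ((m + 1) * k)))) =
      n + n * (√(2 * e ^ 2 / (m + 1)) * √(k * n)) := by
    rw [← h3]
    field_simp
  rw [h4]
  gcongr

/-- For some adversary the regret is at least the mean excess loss of the player when the
coordinates chosen by `J` are preferred. -/
lemma exists_le_regret_of_section (hm : 0 < m) (hA : (blockActions blk).Nonempty)
    (σ : BanditStrategy (blockActions blk)) (J : BlockSection blk) {e : ℝ} (he : |e| < 1 / 2)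
    (n : ℕ) :
    ∃ τ : Adversary (blockActions blk),
      e / 2 * (n * m - ∑ i, expectedCount σ (bias J e) n (J i)) ≤ regret hA σ τ n := by
  have hθ := abs_bias_lt J he
  obtain ⟨τ, hτ⟩ := exists_le_regret hA σ (noisyLoss (m := m)) (bitLaw_pos hθ)
    (sum_bitLaw (bias J e)) n (indicator_mem J)
  refine ⟨τ, le_of_eq_of_le ?_ hτ⟩
  set q := playTransition σ (fun a y => loss a (noisyLoss (m := m) y))
    (fun _ => bitLaw (bias J e)) with hqdef
  have hq : IsTransition q :=
    isTransition_playTransition σ (fun _ ω => (bitLaw_pos hθ ω).le) (fun _ => sum_bitLaw _)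
  -- The excess loss of a round may be replaced by its conditional mean given the action.
  have h1 := sum_pathProb_mul_sum_congr hq
    (f := fun x => loss x.1 (noisyLoss x.2) - loss (indicator J) (noisyLoss x.2))
    (g := fun x => e / 2 * (m - ∑ i, (x.1 : Fin d → ℝ) (J i))) (fun t h => by
      rw [hqdef, sum_playTransition σ _ _ (fun _ => sum_bitLaw _) t h
        (fun a => e / 2 * (m - ∑ i, (a : Fin d → ℝ) (J i))), Fintype.sum_prod_type]
      refine sum_congr rfl fun a _ => ?_
      rw [← sum_bitLaw_mul_loss_sub a.2, mul_sum]
      exact sum_congr rfl fun ω _ => by simp only [playTransition]; ring) n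
  rw [h1]
  -- The player sees the bits only through their count.
  have h2 := sum_pathProb_comp (q := q) (r := countTransition σ (bias J e))
    (fun x => (x.1, trueCount (countedBits (x.1 : Fin d → ℝ)) x.2)) (fun t h y => by
      rw [sum_filter, Fintype.sum_prod_type, sum_eq_single y.1]
      · simp only [hqdef, countTransition, playTransition, countLaw, Prod.ext_iff, true_and,
          ← sum_filter, mul_sum, Function.comp_def, loss_noisyLoss hm (Subtype.prop _)]
      · intro a _ ha
        exact sum_eq_zero fun ω _ => if_neg fun h' => ha (congrArg Prod.fst h')
      · simp) n (fun h => ∑ t, e / 2 * (m - ∑ i, ((h t).1 : Fin d → ℝ) (J i)))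
  simp only [Function.comp_def] at h2
  rw [h2]
  have hq' := isTransition_countTransition σ hθ
  have h3 : ∀ h : Fin n → blockActions blk × Fin (Fintype.card (Fin m ⊕ Fin d) + 1),
      pathProb (countTransition σ (bias J e)) n h *
        ∑ t, e / 2 * (m - ∑ i, ((h t).1 : Fin d → ℝ) (J i)) =
      pathProb (countTransition σ (bias J e)) n h * (e / 2 * (n * m)) -
        e / 2 * ∑ i, pathProb (countTransition σ (bias J e)) n h *
          ∑ t, ((h t).1 : Fin d → ℝ) (J i) := by
    intro h
    rw [← mul_sum, ← mul_sum, sum_sub_distrib, sum_comm]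
    simp only [sum_const, card_univ, Fintype.card_fin, nsmul_eq_mul]
    ring
  simp only [h3]
  rw [sum_sub_distrib, sum_pathProb_mul_const hq', ← mul_sum, sum_comm]
  simp only [expectedCount]
  ring

end LowerBound

/-! ### The residue blocks and the choice of the bias -/

section Residues

variable {m d : ℕ}

/-- The blocks of coordinates with the same residue modulo `m`. Their sizes differ by at most
one, whether or not `m` divides `d`. -/
def residueBlock (hm : 0 < m) (x : Fin d) : Fin m := ⟨x % m, Nat.mod_lt _ hm⟩

lemma card_residueBlock (hm : 0 < m) (i : Fin m) :
    Fintype.card {x : Fin d // residueBlock hm x = i} = d / m ∨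
      Fintype.card {x : Fin d // residueBlock hm x = i} = d / m + 1 := by
  have h : Fintype.card {x : Fin d // residueBlock hm x = i} =
      Nat.count (fun x => x ≡ i [MOD m]) d := by
    rw [Nat.count_eq_card_filter_range, Fintype.card_subtype]
    refine card_nbij (fun x => (x : ℕ)) (fun x hx => ?_) (fun x _ y _ h => Fin.ext h)
      (fun x hx => ?_)
    · have h1 : residueBlock hm x = i := (mem_filter.1 hx).2
      refine mem_filter.2 ⟨mem_range.2 x.2, ?_⟩
      rw [← h1]
      exact (Nat.mod_modEq _ _).symm
    · have h1 := mem_filter.1 (mem_coe.1 hx)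
      refine ⟨⟨x, mem_range.1 h1.1⟩, mem_coe.2 (mem_filter.2 ⟨mem_univ _, Fin.ext ?_⟩), rfl⟩
      have h2 := h1.2
      rwa [Nat.ModEq, Nat.mod_eq_of_lt i.2] at h2
  rw [h, Nat.count_modEq_card _ hm]
  split_ifs <;> simp

lemma sum_card_residueBlock (hm : 0 < m) :
    ∑ i, Fintype.card {x : Fin d // residueBlock hm x = i} = d := by
  rw [← Fintype.card_sigma, Fintype.card_congr (Equiv.sigmaFiberEquiv (residueBlock hm)),
    Fintype.card_fin]

/-- Since the block sizes take only two consecutive values, the sum of their inverses is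
determined by `m` and `d`, and it is close to the value `m² / d` for equal blocks. -/
lemma sum_inv_card_residueBlock_le (hm : 0 < m) (hd : 2 * m ≤ d) :
    (d : ℝ) / m * ∑ i, 1 / (Fintype.card {x : Fin d // residueBlock hm x = i} : ℝ) ≤
      25 / 24 * m := by
  have hm' : (0 : ℝ) < m := by exact_mod_cast hm
  have hK2 : 2 ≤ d / m := (Nat.le_div_iff_mul_le hm).2 hd
  have hK2' : (2 : ℝ) ≤ ((d / m : ℕ) : ℝ) := by exact_mod_cast hK2
  set K : ℝ := ((d / m : ℕ) : ℝ) with hK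
  -- The interpolation of `1 / k` at the two possible sizes `K` and `K + 1`.
  have h1 : ∀ i, 1 / (Fintype.card {x : Fin d // residueBlock hm x = i} : ℝ) =
      (2 * K + 1 - Fintype.card {x : Fin d // residueBlock hm x = i}) / (K * (K + 1)) := by
    intro i
    rcases card_residueBlock (d := d) hm i with h | h
    · rw [h, ← hK]
      field_simp
      ring
    · rw [h]
      push_cast
      rw [← hK]
      field_simp
      ring
  have h2 : ∑ i, (Fintype.card {x : Fin d // residueBlock hm x = i} : ℝ) = d := by
    exact_mod_cast sum_card_residueBlock (d := d) hm
  simp only [h1]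
  rw [← sum_div, sum_sub_distrib, h2, sum_const, card_univ, Fintype.card_fin, nsmul_eq_mul]
  rw [div_mul_div_comm, div_le_iff₀ (by positivity)]
  -- The left side is largest at `d = (K + 1 / 2) m`, and the factor `25 / 24` is reached at `K = 2`.
  nlinarith [sq_nonneg ((d : ℝ) - m * (K + 1 / 2)), mul_pos hm' hm',
    mul_nonneg (mul_pos hm' hm').le (show 0 ≤ K * (K + 1) - 6 by nlinarith)]

/-- For the bias `e = 0.16 √(d / n)`, the preferred coordinates are found in at most three quarters
of all selections. -/
lemma sum_residueBlock_le (hm : 0 < m) (hd : 2 * m ≤ d) {n : ℕ} (hn : 0 < n) :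
    ∑ i : Fin m, (1 / (Fintype.card {x : Fin d // residueBlock hm x = i} : ℝ) +
      √(2 * (0.16 * √(d / n)) ^ 2 * n /
        ((m + 1) * Fintype.card {x : Fin d // residueBlock hm x = i}))) ≤ 0.75 * m := by
  have hm' : (0 : ℝ) < m := by exact_mod_cast hm
  have hn' : (0 : ℝ) < n := by exact_mod_cast hn
  have hK2 : 2 ≤ d / m := (Nat.le_div_iff_mul_le hm).2 hd
  have hk2 : ∀ i, (2 : ℝ) ≤ Fintype.card {x : Fin d // residueBlock hm x = i} := by
    intro i
    rcases card_residueBlock (d := d) hm i with h | h <;> rw [h] <;> exact_mod_cast (by omega)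
  have h1 : ∀ i, 1 / (Fintype.card {x : Fin d // residueBlock hm x = i} : ℝ) +
      √(2 * (0.16 * √(d / n)) ^ 2 * n /
        ((m + 1) * Fintype.card {x : Fin d // residueBlock hm x = i})) ≤
      1 / 2 + 0.1132 * (1 + (d : ℝ) / m *
        (1 / (Fintype.card {x : Fin d // residueBlock hm x = i} : ℝ))) := by
    intro i
    set k : ℝ := (Fintype.card {x : Fin d // residueBlock hm x = i} : ℝ)
    have hk : 2 ≤ k := hk2 i
    have h2 : 1 / k ≤ 1 / 2 := one_div_le_one_div_of_le (by norm_num) hk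
    -- `2 · 0.16² = 0.0512`, and `√(0.0512 u) ≤ 0.1132 (1 + u)` as `0.0512 ≤ 4 · 0.1132²`; the
    -- linear bound in `u` can be summed over the blocks.
    refine add_le_add h2 (Real.sqrt_le_iff.2 ⟨by positivity, ?_⟩)
    rw [mul_pow, Real.sq_sqrt (by positivity)]
    have h3 : 2 * ((0.16 : ℝ) ^ 2 * (d / n)) * n / ((m + 1) * k) ≤
        0.0512 * ((d : ℝ) / m * (1 / k)) := by
      have e1 : 2 * ((0.16 : ℝ) ^ 2 * (d / n)) * n / ((m + 1) * k) =
          0.0512 * (d / ((m + 1) * k)) := by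
        field_simp
        ring
      have e2 : (d : ℝ) / m * (1 / k) = d / (m * k) := by field_simp
      rw [e1, e2]
      gcongr
      linarith
    refine h3.trans ?_
    set u := (d : ℝ) / m * (1 / k)
    nlinarith [sq_nonneg (u - 1), show 0 ≤ u by positivity]
  refine (sum_le_sum fun i _ => h1 i).trans ?_
  have h4 := sum_inv_card_residueBlock_le hm hd
  simp only [sum_add_distrib, ← mul_sum, sum_const, card_univ, Fintype.card_fin, nsmul_eq_mul]
  nlinarith

end Residues

/-- Against zero losses the regret is zero. -/
lemma regret_zero_loss {d : ℕ} {A : Finset (Fin d → ℝ)} (hA : A.Nonempty)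
    (σ : BanditStrategy A) (n : ℕ) : regret hA σ (obliviousAdversary fun _ _ => 0) n = 0 := by
  have h : ∀ b : Fin d → ℝ, loss b (fun _ => 0) = 0 := fun b => by simp [loss]
  simp only [regret, expectation, transcript_snd, h, sum_const_zero, mul_zero, inf'_const,
    sub_self]

lemma exists_residueBlock_le_regret {m d n : ℕ} (hm : 0 < m) (hmd : 2 * m ≤ d) (hdn : d ≤ n)
    (hA : (blockActions (residueBlock (d := d) hm)).Nonempty)
    (σ : BanditStrategy (blockActions (residueBlock (d := d) hm))) :
    ∃ τ, 0.02 * (m : ℝ) * √((d : ℝ) * n) ≤ regret hA σ τ n := by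
  have hm' : (0 : ℝ) < m := by exact_mod_cast hm
  have hd' : (0 : ℝ) < d := by exact_mod_cast (by omega : 0 < d)
  have hn' : (0 : ℝ) < n := by exact_mod_cast (by omega : 0 < n)
  set e : ℝ := 0.16 * √((d : ℝ) / n) with he
  have he0 : 0 ≤ e := by positivity
  have he1 : |e| < 1 / 2 := by
    rw [abs_of_nonneg he0]
    have : √((d : ℝ) / n) ≤ 1 :=
      Real.sqrt_le_one.2 (div_le_one_of_le₀ (by exact_mod_cast hdn) hn'.le)
    rw [he]
    linarith
  obtain ⟨a, ha⟩ := hA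
  obtain ⟨J₀, -⟩ := exists_eq_indicator ha
  have hsum : ∑ J : BlockSection (residueBlock (d := d) hm),
      ∑ i, expectedCount σ (bias J e) n (J i) ≤
        ∑ _J : BlockSection (residueBlock (d := d) hm), (n : ℝ) * (0.75 * m) := by
    rw [sum_comm]
    refine (sum_le_sum fun i _ => sum_section_expectedCount_le σ he1 n i rfl
      (Fintype.card_pos_iff.2 ⟨J₀ i⟩)).trans ?_
    rw [sum_comm]
    refine sum_le_sum fun J _ => ?_
    rw [← mul_sum]
    exact mul_le_mul_of_nonneg_left (sum_residueBlock_le hm hmd (by omega)) hn'.le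
  obtain ⟨J, -, hJ⟩ := exists_le_of_sum_le ⟨J₀, mem_univ _⟩ hsum
  obtain ⟨τ, hτ⟩ := exists_le_regret_of_section hm ⟨a, ha⟩ σ J he1 n
  refine ⟨τ, le_trans ?_ hτ⟩
  have h1 : √((d : ℝ) * n) = √((d : ℝ) / n) * n := by
    have : (d : ℝ) * n = d / n * n ^ 2 := by field_simp
    rw [this, Real.sqrt_mul (by positivity), Real.sqrt_sq hn'.le]
  have h2 : e / 2 * (n * m - n * (0.75 * m)) ≤
      e / 2 * (n * m - ∑ i, expectedCount σ (bias J e) n (J i)) := by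
    gcongr
  refine le_trans (le_of_eq ?_) h2
  rw [h1, he]
  ring

end OnlineCombinatorial

theorem mainTheorem2 (m d n : ℕ) (hmd : 2 * m ≤ d) (hdn : d ≤ n) :
    ∃ (A : Finset (Fin d → ℝ)) (hA : A.Nonempty),
      (∀ a ∈ A, (∀ i, a i = 0 ∨ a i = 1) ∧ ∑ i, |a i| = (m : ℝ)) ∧
      ((0.02 * (m : ℝ) * Real.sqrt ((d : ℝ) * (n : ℝ)) : ℝ) : EReal) ≤
        ⨅ σ : OnlineCombinatorial.BanditStrategy A,
          ⨆ τ : OnlineCombinatorial.Adversary A,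
            ((OnlineCombinatorial.regret hA σ τ n : ℝ) : EReal) := by
  open OnlineCombinatorial in
  rcases Nat.eq_zero_or_pos m with rfl | hm
  · refine ⟨{0}, Finset.singleton_nonempty _, ?_, le_iInf fun σ => ?_⟩
    · simp
    · refine le_iSup_of_le (obliviousAdversary fun _ _ => 0) ?_
      rw [regret_zero_loss]
      simp
  · have hblock : ∀ i : Fin m, Nonempty {x : Fin d // residueBlock hm x = i} := fun i => by
      have h2 : 2 ≤ d / m := (Nat.le_div_iff_mul_le hm).2 hmd
      refine Fintype.card_pos_iff.1 ?_
      rcases card_residueBlock (d := d) hm i with h | h <;> omega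
    have hA : (blockActions (residueBlock (d := d) hm)).Nonempty :=
      ⟨_, indicator_mem fun i => (hblock i).some⟩
    refine ⟨_, hA, fun a ha => ⟨action_eq_zero_or_one ha, sum_abs_action ha⟩,
      le_iInf fun σ => ?_⟩
    obtain ⟨τ, hτ⟩ := exists_residueBlock_le_regret hm hmd hdn hA σ
    exact le_iSup_of_le τ (EReal.coe_le_coe_iff.2 hτ)
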